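/- For an integer $n\ge 0$, let the wheel $W_{n+1}$ be the graph with a central vertex $v_c$ and cycle vertices $v_1,\dots,v_n$, with one spoke $\{v_c,v_i\}$ for each $1\le i\le n$, and with the $n$ cycle edges $\{v_1,v_2\},\{v_2,v_3\},\dots,\{v_{n-1},v_n\},\{v_n,v_1\}$. (It is a simple graph for $n\ge 3$; for $n=2$ the cycle consists of two parallel edges joining $v_1$ and $v_2$, and for $n=1$ it is a loop at $v_1$.) A spanning forest of a graph is a subgraph that contains all vertices and no cycle, where a loop is a cycle of length $1$ and two parallel edges form a cycle of length $2$; a spanning tree is a connected spanning forest. Let $\mathscr{T}(G)$ be the number of spanning trees of $G$. Let $f_i$ be the Fibonacci numbers ($f_0=0$, $f_1=1$, $f_{i+2}=f_{i+1}+f_i$) and $\ell_j$ the Lucas numbers ($\ell_0=2$, $\ell_1=1$, $\ell_{j+2}=\ell_{j+1}+\ell_j$). Theorem. Let $v_a$ and $v_b$ be two distinct cycle vertices of $W_{n+1}$, and let $k=\min(|a-b|,\,n-|a-b|)$ be their cycle distance. Then the number $F_{W_{n+1}}(v_a\mid v_b)$ of spanning forests of $W_{n+1}$ that have exactly two components and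 in which $v_a$ and $v_b$ lie in different components is $$F_{W_{n+1}}(v_a\mid v_b)=f_{2k}\,\mathscr{T}(W_{n+1})-f_{2n}\,\mathscr{T}(W_{k+1})=f_{2k}(\ell_{2n}-2)-f_{2n}(\ell_{2k}-2).$$ -/

import Mathlib

namespace WheelForests

/-- The wheel `W_{n+1}`, with centre `none` and rim vertices `some i`, `i : Fin n`.
`Sum.inl i` is the spoke joining the centre to the rim vertex `i`, and `Sum.inr i` is the rim edge
joining the rim vertices `i` and `i + 1`, taken cyclically (`finRotate n i` is `i + 1` mod `n`).
It is a multigraph so that it makes sense for all `n`: it is simple for `n ≥ 3`, the rim is a pair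
of parallel edges for `n = 2` and a loop for `n = 1`, and for `n = 0` only the centre is left. -/
def wheel (n : ℕ) : Graph (Option (Fin n)) (Fin n ⊕ Fin n) where
  vertexSet := Set.univ
  IsLink e x y := match e with
    | Sum.inl i => s(x, y) = s(none, some i)
    | Sum.inr i => s(x, y) = s(some i, some (finRotate n i))
  isLink_symm := by
    intro e _
    constructor
    rintro x y h
    cases e <;> simpa only [Sym2.eq_swap (a := y)] using h
  eq_or_eq_of_isLink_of_isLink := by
    intro e x y v w h h'
    cases e <;>
    · have := h.trans h'.symm
      rw [Sym2.eq_iff] at this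
      tauto
  left_mem_of_isLink := by
    intro e x y _
    exact Set.mem_univ x

variable {α β : Type*}

/-- Two vertices are connected in `H` if some walk of `H` joins them. -/
def Connected (H : Graph α β) (x y : α) : Prop := Relation.ReflTransGen H.Adj x y

/-- Connectedness as an equivalence relation on the vertex set of `H`. -/
def componentSetoid (H : Graph α β) : Setoid H.vertexSet where
  r x y := Connected H x y
  iseqv :=
    { refl := fun _ => Relation.ReflTransGen.refl
      symm := fun h => (Relation.ReflTransGen.stdSymm (r := H.Adj)).symm _ _ h
      trans := fun h h' => Relation.ReflTransGen.trans h h' }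

/-- The number of connected components of `H`. -/
noncomputable def numComponents (H : Graph α β) : ℕ := Nat.card (Quotient (componentSetoid H))

/-- `H` has no cycle. A cycle of length `m + 1` is a cyclic sequence of `m + 1` distinct vertices
in which consecutive vertices are joined by `m + 1` distinct edges; a loop is a cycle of length `1`,
and a pair of parallel edges gives one of length `2`. -/
def IsAcyclic (H : Graph α β) : Prop :=
  ¬ ∃ (m : ℕ) (x : Fin (m + 1) → α) (e : Fin (m + 1) → β),
    Function.Injective x ∧ Function.Injective e ∧ ∀ i, H.IsLink (e i) (x i) (x (i + 1))

/-- The spanning forests of `G` with exactly `c` components. -/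
def spanningForests (G : Graph α β) (c : ℕ) : Set (Graph α β) :=
  {H | H.IsSpanningSubgraph G ∧ IsAcyclic H ∧ numComponents H = c}

/-- `𝒯(G)`, the number of spanning trees (connected spanning forests) of `G`. -/
noncomputable def numSpanningTrees (G : Graph α β) : ℕ := (spanningForests G 1).ncard

/-- `F_G(u ∣ v)`, the number of two-component spanning forests of `G` in which the vertices
`u` and `v` of `G` lie in different components. -/
noncomputable def numSeparatingForests (G : Graph α β) (u v : α) : ℕ :=
  {H ∈ spanningForests G 2 | ¬ Connected H u v}.ncard

/-- Lucas numbers: `ℓ₀ = 2`, `ℓ₁ = 1`, `ℓ_{j+2} = ℓ_{j+1} + ℓ_j`. -/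
def lucas : ℕ → ℕ
  | 0 => 2
  | 1 => 1
  | j + 2 => lucas (j + 1) + lucas j

/-- The cycle distance `min (|u - v|, n - |u - v|)` of two rim vertices. -/
def cycleDist {n : ℕ} (u v : Fin n) : ℕ :=
  min ((u : ℤ) - (v : ℤ)).natAbs (n - ((u : ℤ) - (v : ℤ)).natAbs)

end WheelForests

/-! Choosing a root in each component turns a forest into the assignment of a parent edge to every
other vertex. In the wheel the centre is always taken as a root, so a forest becomes a cyclic word
over `spoke`, `right`, `left`, with a gap at each rim root. A word arises this way iff no `right` is
followed by `left` (one rim edge would be used twice) and it is neither all `right` nor all `left`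
(the rim would close up). This is `IsParentWord`; by `RootedAt.parentEdge_unique` the forest and its
roots determine the word.

Linear words of length `m` without `right left` number f_{2m+2} (`ncard_noRightLeft`). Spanning
trees are the words without gaps: from f_{2n+2} linear words remove the f_{2n-2} that fail across
the wrap-around and the 2 constant ones, leaving ℓ_{2n} - 2.

In a separating forest the centre lies with exactly one of the two vertices, say `v`. Rooting the
other component at `u` cuts the rim into a linear word of length n-1, giving f_{2n} words. Those to
be discarded have `v` in the tree of `u`: all letters on one of the two arcs from `v` to `u` point
towards `u`, which leaves f_{2k} or f_{2(n-k)} words. By symmetry F = 2(f_{2n} - f_{2k} -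
f_{2(n-k)}), and d'Ocagne's identity (`fib_mul_fib_sub`) gives the stated form. -/

namespace WheelForests

/-! ### Rooted forests in arbitrary multigraphs -/

/-- `H` is a forest rooted at `R`: each vertex `x` outside `R` has a parent `pv x`, to which it is
joined by the edge `pe x`, the height `h` drops from a vertex to its parent, and every edge of `H`
joins a vertex to its parent. -/
structure RootedAt {α β : Type*} (H : Graph α β) (R : Set α) (pe : α → β) (pv : α → α)
    (h : α → ℕ) : Prop where
  isLink : ∀ x ∉ R, H.IsLink (pe x) x (pv x)
  height_lt : ∀ x ∉ R, h (pv x) < h x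
  edge_eq : ∀ e ∈ H.edgeSet, ∃ x ∉ R, pe x = e

section Generic

variable {α β : Type*} {H K : Graph α β} {R : Set α} {pe : α → β} {pv : α → α} {h : α → ℕ}

theorem Connected.symm {x y : α} (hxy : Connected H x y) : Connected H y x :=
  (Relation.ReflTransGen.stdSymm (r := H.Adj)).symm _ _ hxy

theorem Connected.trans {x y z : α} (hxy : Connected H x y) (hyz : Connected H y z) :
    Connected H x z :=
  Relation.ReflTransGen.trans hxy hyz

theorem connected_of_isLink {e : β} {x y : α} (he : H.IsLink e x y) : Connected H x y :=
  Relation.ReflTransGen.single ⟨e, he⟩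

theorem Connected.mono (hHK : H ≤ K) {x y : α} (hxy : Connected H x y) : Connected K x y :=
  Relation.ReflTransGen.mono (r := H.Adj) (p := K.Adj) (fun _ _ hab => Graph.Adj.mono hHK hab)
    _ _ hxy

namespace RootedAt

theorem eq_parentEdge (hF : RootedAt H R pe pv h) {e : β} {x y : α} (he : H.IsLink e x y)
    (hyx : h y ≤ h x) : x ∉ R ∧ e = pe x ∧ y = pv x := by
  obtain ⟨z, hz, rfl⟩ := hF.edge_eq e he.edge_mem
  obtain ⟨rfl, rfl⟩ | ⟨rfl, rfl⟩ := (hF.isLink z hz).eq_and_eq_or_eq_and_eq he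
  · exact ⟨hz, rfl, rfl⟩
  · exact absurd (hF.height_lt z hz) (by omega)

/-- At a highest vertex of a cycle both incident cycle edges must be its parent edge. They then
coincide, so the cycle is a loop, whose vertex would be its own parent. -/
theorem isAcyclic (hF : RootedAt H R pe pv h) : IsAcyclic H := by
  rintro ⟨m, x, e, -, he, hl⟩
  obtain ⟨i, hi⟩ := Finite.exists_max fun i => h (x i)
  have h1 := hF.eq_parentEdge (hl i) (hi _)
  have h2 := hl (i - 1)
  rw [sub_add_cancel] at h2
  have h3 := hF.eq_parentEdge h2.symm (hi _)
  have h4 : i = i - 1 := he (h1.2.1.trans h3.2.1.symm)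
  have h5 := hF.height_lt _ h3.1
  rw [← h3.2.2, ← h4] at h5
  exact lt_irrefl _ h5

/-- The root of the tree of each vertex. -/
theorem exists_root (hF : RootedAt H R pe pv h) :
    ∃ ρ : α → α, (∀ x, ρ x ∈ R) ∧ (∀ x ∈ R, ρ x = x) ∧ (∀ x, Connected H x (ρ x)) ∧
      ∀ x y, Connected H x y ↔ ρ x = ρ y := by
  have main : ∃ ρ : α → α, (∀ x ∈ R, ρ x = x) ∧ ∀ x ∉ R, ρ x = ρ (pv x) := by
    classical
    -- Roots are fixed by `f`, so iterating `h x` times is enough to reach the root of `x`, and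
    -- further iterations change nothing.
    let f : α → α := fun x => if x ∈ R then x else pv x
    have hfR : ∀ x ∈ R, ∀ k, f^[k] x = x := fun x hx k =>
      Function.iterate_fixed (f := f) (if_pos hx) k
    have hmem : ∀ k x, h x ≤ k → f^[k] x ∈ R := by
      intro k
      induction k with
      | zero =>
        intro x hx
        by_contra hxR
        have := hF.height_lt x hxR
        omega
      | succ k ih =>
        intro x hx
        by_cases hxR : x ∈ R
        · rw [hfR x hxR]; exact hxR
        · rw [Function.iterate_succ_apply]
          apply ih
          have := hF.height_lt x hxR
          simp only [f, if_neg hxR]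
          omega
    have hstab : ∀ k x, h x ≤ k → f^[k] x = f^[h x] x := by
      intro k x hk
      obtain ⟨d, rfl⟩ := Nat.exists_eq_add_of_le' hk
      rw [Function.iterate_add_apply, hfR _ (hmem _ x le_rfl)]
    refine ⟨fun x => f^[h x] x, fun x hx => hfR x hx _, fun x hx => ?_⟩
    have hlt := hF.height_lt x hx
    obtain ⟨j, hj⟩ := Nat.exists_eq_add_one_of_ne_zero (Nat.ne_zero_of_lt hlt)
    change f^[h x] x = f^[h (pv x)] (pv x)
    rw [hj, Function.iterate_succ_apply]
    simp only [f, if_neg hx]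
    exact hstab j (pv x) (by omega)
  obtain ⟨ρ, hρ, hρ'⟩ := main
  have hind : ∀ k x, h x ≤ k → ρ x ∈ R ∧ Connected H x (ρ x) := by
    intro k
    induction k with
    | zero =>
      intro x hx
      by_cases hxR : x ∈ R
      · rw [hρ x hxR]; exact ⟨hxR, .refl⟩
      · have := hF.height_lt x hxR
        omega
    | succ k ih =>
      intro x hx
      by_cases hxR : x ∈ R
      · rw [hρ x hxR]; exact ⟨hxR, .refl⟩
      · have := hF.height_lt x hxR
        rw [hρ' x hxR]
        obtain ⟨h1, h2⟩ := ih (pv x) (by omega)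
        exact ⟨h1, (connected_of_isLink (hF.isLink x hxR)).trans h2⟩
  have hadj : ∀ x y, H.Adj x y → ρ x = ρ y := by
    rintro x y ⟨e, he⟩
    obtain ⟨z, hz, rfl⟩ := hF.edge_eq e he.edge_mem
    obtain ⟨rfl, rfl⟩ | ⟨rfl, rfl⟩ := (hF.isLink z hz).eq_and_eq_or_eq_and_eq he
    · exact hρ' _ hz
    · exact (hρ' _ hz).symm
  refine ⟨ρ, fun x => (hind _ x le_rfl).1, hρ, fun x => (hind _ x le_rfl).2, fun x y => ⟨?_, ?_⟩⟩
  · intro hxy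
    induction hxy with
    | refl => rfl
    | tail _ hab ih => exact ih.trans (hadj _ _ hab)
  · intro hxy
    have h1 := (hind _ x le_rfl).2
    rw [hxy] at h1
    exact h1.trans (hind _ y le_rfl).2.symm

theorem numComponents_eq (hF : RootedAt H R pe pv h) (hV : H.vertexSet = Set.univ) :
    numComponents H = R.ncard := by
  obtain ⟨ρ, hR, hfix, -, hconn⟩ := hF.exists_root
  rw [numComponents, ← Nat.card_coe_set_eq]
  refine Nat.card_congr (Equiv.ofBijective
    (Quotient.lift (fun x : H.vertexSet => (⟨ρ x, hR x⟩ : R))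
      fun a b hab => Subtype.ext ((hconn a b).1 hab)) ⟨?_, ?_⟩)
  · intro a b
    induction a using Quotient.inductionOn
    induction b using Quotient.inductionOn
    intro hab
    exact Quotient.sound ((hconn _ _).2 (congrArg Subtype.val hab))
  · rintro ⟨r, hr⟩
    exact ⟨Quotient.mk _ ⟨r, hV ▸ Set.mem_univ r⟩, Subtype.ext (hfix r hr)⟩

/-- The parent edges are determined by the forest and its roots. -/
theorem parentEdge_unique [Finite α] {pe' : α → β} {pv' : α → α} {h' : α → ℕ}
    (hF : RootedAt H R pe pv h) (hF' : RootedAt H R pe' pv' h') {x : α} (hx : x ∉ R) :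
    pe x = pe' x := by
  by_contra hne
  -- Take a disagreement `y` of maximal `h`. Its second parent edge must go up in `h`, so it is the
  -- first parent edge of `pv' y`. The rootings agree there, so `y` and `pv' y` are each other's
  -- second parents.
  obtain ⟨y, ⟨hyR, hy⟩, hmax⟩ := Set.exists_max_image {x | x ∉ R ∧ pe x ≠ pe' x} h
    (Set.toFinite _) ⟨x, hx, hne⟩
  have hl := hF'.isLink y hyR
  have hlt : h y < h (pv' y) := by
    by_contra hle
    exact hy (hF.eq_parentEdge hl (not_lt.1 hle)).2.1.symm
  obtain ⟨hz, hz1, hz2⟩ := hF.eq_parentEdge hl.symm hlt.le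
  have heq : pe (pv' y) = pe' (pv' y) := by
    by_contra hcon
    exact absurd (hmax _ ⟨hz, hcon⟩) (not_le.2 hlt)
  have h1 := hF'.isLink _ hz
  rw [← heq, ← hz1] at h1
  have h2 : pv' (pv' y) = y := by
    rw [Graph.IsLink.isLink_iff_eq hl.symm] at h1
    exact h1
  have h3 := hF'.height_lt _ hz
  rw [h2] at h3
  exact absurd (hF'.height_lt _ hyR) (by omega)

end RootedAt

/-- In an acyclic graph every edge is a bridge. -/
theorem IsAcyclic.not_connected_of_isLink (hH : IsAcyclic H) (hKH : K ≤ H) {e : β} {x y : α}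
    (he : H.IsLink e x y) (heK : e ∉ K.edgeSet) : ¬ Connected K x y := by
  intro hconn
  -- Passing to a simple graph provides a path without repeated vertices; its edges are then lifted
  -- back to `K`.
  let S : SimpleGraph α := SimpleGraph.fromRel K.Adj
  have hreach : S.Reachable x y := by
    clear he
    induction hconn with
    | refl => rfl
    | @tail b c _ hab ih =>
      by_cases hbc : b = c
      · exact hbc ▸ ih
      · exact ih.trans
          (SimpleGraph.Adj.reachable ((SimpleGraph.fromRel_adj _ _ _).2 ⟨hbc, .inl hab⟩))
  clear hconn
  obtain ⟨p, hp⟩ := hreach.exists_isPath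
  have hadj : ∀ i : Fin p.length, ∃ f, K.IsLink f (p.getVert i) (p.getVert (i + 1)) := by
    intro i
    rcases ((SimpleGraph.fromRel_adj _ _ _).1 (p.adj_getVert_succ i.2)).2 with h1 | h1
    · exact h1
    · exact h1.symm
  choose f hf using hadj
  have hinj := hp.getVert_injOn
  -- The cycle runs along the path from `x` to `y` and returns by `e`, placed last.
  refine hH ⟨p.length, fun i => p.getVert i, Fin.snoc (α := fun _ => β) f e, ?_, ?_, ?_⟩
  · intro i j hij
    exact Fin.ext (hinj (Nat.le_of_lt_succ i.2) (Nat.le_of_lt_succ j.2) hij)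
  · have hfe : ∀ i, f i ≠ e := fun i hi => heK (hi ▸ (hf i).edge_mem)
    intro i j
    induction i using Fin.lastCases with
    | last =>
      induction j using Fin.lastCases with
      | last => exact fun _ => rfl
      | cast j =>
        intro hij
        simp only [Fin.snoc_last, Fin.snoc_castSucc] at hij
        exact absurd hij.symm (hfe j)
    | cast i =>
      induction j using Fin.lastCases with
      | last =>
        intro hij
        simp only [Fin.snoc_last, Fin.snoc_castSucc] at hij
        exact absurd hij (hfe i)
      | cast j =>
        intro hij
        simp only [Fin.snoc_castSucc] at hij
        have h1 := hf j
        rw [← hij] at h1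
        have hi := i.2
        have hj := j.2
        rcases (hf i).eq_and_eq_or_eq_and_eq h1 with ⟨h2, -⟩ | ⟨h2, h3⟩
        · have := hinj (by simp) (by simp) h2
          exact congrArg _ (Fin.ext this)
        · have h4 := hinj (by simp) (Set.mem_ofPred.2 (by omega)) h2
          have h5 := hinj (Set.mem_ofPred.2 (by omega)) (by simp) h3
          omega
  · intro i
    induction i using Fin.lastCases with
    | last => simpa using he.symm
    | cast i =>
      have := (hf i).mono hKH
      simpa [Fin.val_add_one_of_lt (Fin.castSucc_lt_last i)] using this

/-- An acyclic graph is rooted at any transversal of its components. -/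
theorem IsAcyclic.exists_rootedAt [Nonempty β] (hH : IsAcyclic H)
    (hR : ∀ x, ∃ r ∈ R, Connected H x r) (hR' : ∀ r ∈ R, ∀ s ∈ R, Connected H r s → r = s) :
    ∃ pe pv h, RootedAt H R pe pv h := by
  classical
  -- `L k` holds the vertices with a walk of length `k` to `R`; the height is the distance to `R`.
  let L : ℕ → Set α := fun k => Nat.rec R (fun _ s => {x | ∃ e, ∃ y ∈ s, H.IsLink e x y}) k
  have hL : ∀ x, ∃ k, x ∈ L k := by
    intro x
    obtain ⟨r, hr, hxr⟩ := hR x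
    induction hxr using Relation.ReflTransGen.head_induction_on with
    | refl => exact ⟨0, hr⟩
    | head hab _ ih =>
      obtain ⟨k, hk⟩ := ih
      obtain ⟨e, he⟩ := hab
      exact ⟨k + 1, e, _, hk, he⟩
  let h : α → ℕ := fun x => @Nat.find (fun k => x ∈ L k) (fun _ => Classical.propDecidable _) (hL x)
  have hpar : ∀ x, ∃ e y, x ∉ R → H.IsLink e x y ∧ h y < h x := by
    intro x
    by_cases hx : x ∈ R
    · exact ⟨Classical.arbitrary β, x, fun hc => absurd hx hc⟩
    · have hspec : x ∈ L (h x) := @Nat.find_spec _ (fun _ => Classical.propDecidable _) (hL x)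
      obtain ⟨k, hk⟩ := Nat.exists_eq_add_one_of_ne_zero (n := h x) (by
        intro h0
        rw [h0] at hspec
        exact hx hspec)
      rw [hk] at hspec
      obtain ⟨e, y, hy, he⟩ := hspec
      exact ⟨e, y, fun _ => ⟨he, by
        have : h y ≤ k := @Nat.find_min' _ (fun _ => Classical.propDecidable _) (hL y) _ hy
        omega⟩⟩
  choose pe pv hp using hpar
  refine ⟨pe, pv, h, ⟨fun x hx => (hp x hx).1, fun x hx => (hp x hx).2, ?_⟩⟩
  by_contra hcon
  push Not at hcon
  obtain ⟨e, he, hne⟩ := hcon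
  obtain ⟨x, y, hxy⟩ := H.exists_isLink_of_mem_edgeSet he
  -- Keep only the parent edges. An edge left over would join two vertices with the same root, hence
  -- already connected in `K`, against acyclicity.
  let K := H.restrict {e | ∃ x ∉ R, pe x = e}
  have hKH : K ≤ H := Graph.restrict_le
  have hK : RootedAt K R pe pv h := by
    refine ⟨fun x hx => ⟨⟨x, hx, rfl⟩, (hp x hx).1⟩, fun x hx => (hp x hx).2, fun e he => he.2⟩
  obtain ⟨ρ, h1, -, h3, h4⟩ := hK.exists_root
  refine hH.not_connected_of_isLink hKH hxy (fun hc => ?_) ((h4 x y).2 ?_)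
  · obtain ⟨z, hz, hz'⟩ := hc.2
    exact hne z hz hz'
  · exact hR' _ (h1 x) _ (h1 y) (((h3 x).symm.mono hKH).trans
      ((connected_of_isLink hxy).trans ((h3 y).mono hKH)))

end Generic

/-! ### Parent words on the wheel -/

/-- The three edges at a rim vertex of a wheel. -/
inductive Dir
  | spoke
  | right
  | left
  deriving DecidableEq

instance : Fintype Dir := ⟨{Dir.spoke, Dir.right, Dir.left}, by rintro (_ | _ | _) <;> simp⟩

section Wheel

open Dir

variable {m : ℕ}

/-- The edge that leaves the rim vertex `i` in the direction `d`. -/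
def dirEdge (i : Fin (m + 1)) : Dir → Fin (m + 1) ⊕ Fin (m + 1)
  | spoke => .inl i
  | right => .inr i
  | left => .inr (i - 1)

/-- The neighbour of the rim vertex `i` in the direction `d`. -/
def dirEnd (i : Fin (m + 1)) : Dir → Option (Fin (m + 1))
  | spoke => none
  | right => some (i + 1)
  | left => some (i - 1)

theorem wheel_isLink_some_iff (e : Fin (m + 1) ⊕ Fin (m + 1)) (i : Fin (m + 1))
    (y : Option (Fin (m + 1))) :
    (wheel (m + 1)).IsLink e (some i) y ↔ ∃ d, e = dirEdge i d ∧ y = dirEnd i d := by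
  rcases e with j | j
  · change s(some i, y) = s(none, some j) ↔ _
    rw [Sym2.eq_iff]
    constructor
    · rintro (⟨h, -⟩ | ⟨h, rfl⟩)
      · simp at h
      · obtain rfl := Option.some.inj h
        exact ⟨spoke, rfl, rfl⟩
    · rintro ⟨d, h, rfl⟩
      cases d <;> simp_all [dirEdge, dirEnd]
  · change s(some i, y) = s(some j, some (finRotate _ j)) ↔ _
    rw [Sym2.eq_iff, finRotate_apply]
    constructor
    · rintro (⟨h, rfl⟩ | ⟨h, rfl⟩)
      · obtain rfl := Option.some.inj h
        exact ⟨right, rfl, rfl⟩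
      · obtain rfl := Option.some.inj h
        exact ⟨left, by simp [dirEdge], by simp [dirEnd]⟩
    · rintro ⟨d, h, rfl⟩
      cases d <;> simp_all [dirEdge, dirEnd]

/-- The spanning subgraph of the wheel formed by the edges that `p` assigns to the rim vertices. -/
def wordGraph (p : Fin (m + 1) → Option Dir) :
    Graph (Option (Fin (m + 1))) (Fin (m + 1) ⊕ Fin (m + 1)) :=
  (wheel (m + 1)).restrict {e | ∃ i d, p i = some d ∧ dirEdge i d = e}

/-- The centre and the rim vertices to which `p` assigns no edge. -/
def wordRoots (p : Fin (m + 1) → Option Dir) : Set (Option (Fin (m + 1))) :=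
  {x | ∀ i, x = some i → p i = none}

/-- `p` assigns to the vertices of a forest the edges to their parents. -/
structure IsParentWord (p : Fin (m + 1) → Option Dir) : Prop where
  not_right_left : ∀ i, p i = some right → p (i + 1) ≠ some left
  exists_ne_right : ∃ i, p i ≠ some right
  exists_ne_left : ∃ i, p i ≠ some left

@[simp] theorem none_mem_wordRoots (p : Fin (m + 1) → Option Dir) : none ∈ wordRoots p := by
  simp [wordRoots]

@[simp] theorem some_mem_wordRoots (p : Fin (m + 1) → Option Dir) (i : Fin (m + 1)) :
    some i ∈ wordRoots p ↔ p i = none := by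
  simp [wordRoots]

theorem wordGraph_le (p : Fin (m + 1) → Option Dir) : wordGraph p ≤ wheel (m + 1) :=
  Graph.restrict_le

theorem wordGraph_isSpanningSubgraph (p : Fin (m + 1) → Option Dir) :
    (wordGraph p).IsSpanningSubgraph (wheel (m + 1)) :=
  ⟨wordGraph_le p, rfl⟩

theorem wordGraph_isLink {p : Fin (m + 1) → Option Dir} {i : Fin (m + 1)} {d : Dir}
    (h : p i = some d) : (wordGraph p).IsLink (dirEdge i d) (some i) (dirEnd i d) :=
  ⟨⟨i, d, h, rfl⟩, (wheel_isLink_some_iff _ _ _).2 ⟨d, rfl, rfl⟩⟩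

theorem IsParentWord.exists_rootedAt {p : Fin (m + 1) → Option Dir} (hp : IsParentWord p) :
    ∃ pe pv h, RootedAt (wordGraph p) (wordRoots p) pe pv h ∧
      ∀ i d, p i = some d → pe (some i) = dirEdge i d ∧ pv (some i) = dirEnd i d := by
  obtain ⟨a, ha⟩ := hp.exists_ne_right
  obtain ⟨b, hb⟩ := hp.exists_ne_left
  -- A run of `right` must stop by `a`, where the letter is not `right`, so the distance to `a`
  -- serves as height; likewise `b` for `left`. The offset 2 puts runs above roots (0) and spokes
  -- (1).
  let g : Fin (m + 1) → Option Dir → ℕ := fun i o => match o with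
    | none => 0
    | some spoke => 1
    | some right => 2 + (a - i).val
    | some left => 2 + (i - b).val
  let h : Option (Fin (m + 1)) → ℕ := fun x => match x with
    | none => 0
    | some i => g i (p i)
  let pe : Option (Fin (m + 1)) → Fin (m + 1) ⊕ Fin (m + 1) := fun x => match x with
    | none => .inl 0
    | some i => dirEdge i ((p i).getD spoke)
  let pv : Option (Fin (m + 1)) → Option (Fin (m + 1)) := fun x => match x with
    | none => none
    | some i => dirEnd i ((p i).getD spoke)
  have hpe : ∀ i d, p i = some d → pe (some i) = dirEdge i d ∧ pv (some i) = dirEnd i d := by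
    intro i d hd
    simp [pe, pv, hd]
  have hroot : ∀ x ∉ wordRoots p, ∃ i d, x = some i ∧ p i = some d := by
    intro x hx
    rcases x with - | i
    · simp at hx
    · rw [some_mem_wordRoots] at hx
      obtain ⟨d, hd⟩ := Option.ne_none_iff_exists'.1 hx
      exact ⟨i, d, rfl, hd⟩
  refine ⟨pe, pv, h, ⟨fun x hx => ?_, fun x hx => ?_, fun e he => ?_⟩, hpe⟩
  · obtain ⟨i, d, rfl, hd⟩ := hroot x hx
    rw [(hpe i d hd).1, (hpe i d hd).2]
    exact wordGraph_isLink hd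
  · obtain ⟨i, d, rfl, hd⟩ := hroot x hx
    rw [(hpe i d hd).2]
    have hi : h (some i) = g i (some d) := by simp only [h, hd]
    rw [hi]
    cases d with
    | spoke => exact Nat.zero_lt_one
    | right =>
      change g (i + 1) (p (i + 1)) < 2 + (a - i).val
      have hne : a - i ≠ 0 := fun h0 => ha (sub_eq_zero.1 h0 ▸ hd)
      have h1 := Fin.val_sub_one_of_ne_zero hne
      have h2 := Fin.val_ne_zero_iff.2 hne
      have h3 := hp.not_right_left i hd
      rcases h4 : p (i + 1) with - | - | - | -
      · simp only [g]; omega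
      · simp only [g]; omega
      · simp only [g, ← sub_sub]
        omega
      · exact absurd h4 h3
    | left =>
      change g (i - 1) (p (i - 1)) < 2 + (i - b).val
      have hne : i - b ≠ 0 := fun h0 => hb (sub_eq_zero.1 h0 ▸ hd)
      have h1 := Fin.val_sub_one_of_ne_zero hne
      have h2 := Fin.val_ne_zero_iff.2 hne
      rcases h4 : p (i - 1) with - | - | - | -
      · simp only [g]; omega
      · simp only [g]; omega
      · exact absurd (by rwa [sub_add_cancel]) (hp.not_right_left _ h4)
      · simp only [g, sub_right_comm i 1 b]
        omega
  · obtain ⟨-, i, d, hd, rfl⟩ := he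
    exact ⟨some i, by simp [hd], (hpe i d hd).1⟩

theorem IsParentWord.isAcyclic {p : Fin (m + 1) → Option Dir} (hp : IsParentWord p) :
    IsAcyclic (wordGraph p) := by
  obtain ⟨pe, pv, h, hF, -⟩ := hp.exists_rootedAt
  exact hF.isAcyclic

theorem IsParentWord.numComponents_eq {p : Fin (m + 1) → Option Dir} (hp : IsParentWord p) :
    numComponents (wordGraph p) = (wordRoots p).ncard := by
  obtain ⟨pe, pv, h, hF, -⟩ := hp.exists_rootedAt
  exact hF.numComponents_eq rfl

theorem IsParentWord.ext {p q : Fin (m + 1) → Option Dir} (hp : IsParentWord p)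
    (hq : IsParentWord q) (hr : ∀ i, p i = none ↔ q i = none) (hg : wordGraph p = wordGraph q) :
    p = q := by
  obtain ⟨pe, pv, h, hF, hpe⟩ := hp.exists_rootedAt
  obtain ⟨pe', pv', h', hF', hpe'⟩ := hq.exists_rootedAt
  have hroots : wordRoots q = wordRoots p := by
    ext x
    simp [wordRoots, hr]
  rw [← hg, hroots] at hF'
  funext i
  rcases hd : p i with - | d
  · exact ((hr i).1 hd).symm
  rcases hd' : q i with - | d'
  · rw [(hr i).2 hd'] at hd
    cases hd
  have hi : some i ∉ wordRoots p := by simp [hd]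
  have h1 := hF.parentEdge_unique hF' hi
  have h2 := hF.height_lt _ hi
  have h3 := hF'.height_lt _ hi
  rw [(hpe i d hd).1, (hpe' i d' hd').1] at h1
  rw [(hpe i d hd).2] at h2
  rw [(hpe' i d' hd').2] at h3
  -- Only for `m = 0` do `right` and `left` name the same edge, a loop; the strict drop in height
  -- excludes it.
  have key : i = i - 1 → i + 1 = i := fun h => eq_sub_iff_add_eq.1 h
  cases d <;> cases d' <;> simp only [dirEdge, dirEnd, reduceCtorEq, Sum.inr.injEq] at h1 h2 h3 ⊢
  · rw [key h1] at h2
    exact absurd h2 (lt_irrefl _)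
  · rw [key h1.symm] at h3
    exact absurd h3 (lt_irrefl _)

/-- Each letter is read off from a parent edge. A factor `right left` would make two heights smaller
than each other, and a constant rim word would give the lowest rim vertex a lower parent. -/
theorem RootedAt.exists_isParentWord
    {H : Graph (Option (Fin (m + 1))) (Fin (m + 1) ⊕ Fin (m + 1))} {R : Set (Option (Fin (m + 1)))}
    {pe : Option (Fin (m + 1)) → Fin (m + 1) ⊕ Fin (m + 1)}
    {pv : Option (Fin (m + 1)) → Option (Fin (m + 1))} {h : Option (Fin (m + 1)) → ℕ}
    (hF : RootedAt H R pe pv h) (hH : H.IsSpanningSubgraph (wheel (m + 1))) (hR : none ∈ R) :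
    ∃ p, IsParentWord p ∧ wordGraph p = H ∧ ∀ i, p i = none ↔ some i ∈ R := by
  have hex : ∀ i, ∃ o : Option Dir, (o = none ↔ some i ∈ R) ∧
      ∀ d, o = some d → pe (some i) = dirEdge i d ∧ pv (some i) = dirEnd i d := by
    intro i
    by_cases hi : some i ∈ R
    · exact ⟨none, by simp [hi], by simp⟩
    · obtain ⟨d, hd⟩ := (wheel_isLink_some_iff _ _ _).1 ((hF.isLink _ hi).mono hH.le)
      exact ⟨some d, by simp [hi], by rintro _ ⟨⟩; exact hd⟩
  choose p hp hp' using hex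
  have hlt : ∀ i d, p i = some d → h (dirEnd i d) < h (some i) := by
    intro i d hd
    rw [← (hp' i d hd).2]
    exact hF.height_lt _ fun hi => by simp [(hp i).2 hi] at hd
  refine ⟨p, ⟨fun i hi hi' => ?_, ?_, ?_⟩, ?_, hp⟩
  · have h1 := hlt _ _ hi
    have h2 := hlt _ _ hi'
    simp only [dirEnd, add_sub_cancel_right] at h1 h2
    exact lt_asymm h1 h2
  · by_contra! hall
    obtain ⟨i, hi⟩ := Finite.exists_min fun i => h (some i)
    exact absurd (hi (i + 1)) (not_le.2 (hlt _ _ (hall i)))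
  · by_contra! hall
    obtain ⟨i, hi⟩ := Finite.exists_min fun i => h (some i)
    exact absurd (hi (i - 1)) (not_le.2 (hlt _ _ (hall i)))
  · refine (Graph.Compatible.of_le_le (wordGraph_le p) hH.le).ext hH.vertexSet_eq.symm ?_
    ext e
    constructor
    · rintro ⟨-, i, d, hd, rfl⟩
      rw [← (hp' i d hd).1]
      exact (hF.isLink _ fun hi => by simp [(hp i).2 hi] at hd).edge_mem
    · intro he
      refine ⟨Graph.IsSubgraph.edgeSet_mono hH.le he, ?_⟩
      obtain ⟨x, hx, rfl⟩ := hF.edge_eq e he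
      rcases x with - | i
      · exact absurd hR hx
      · obtain ⟨d, hd⟩ := Option.ne_none_iff_exists'.1 (mt (hp i).1 hx)
        exact ⟨i, d, hd, (hp' i d hd).1.symm⟩

end Wheel

/-! ### Spanning forests of the wheel as words -/

section Forests

open Dir

variable {m : ℕ}

theorem connected_of_numComponents_eq_one {α β : Type*} {H : Graph α β}
    (hV : H.vertexSet = Set.univ) (hH : numComponents H = 1) (x y : α) : Connected H x y := by
  have : Subsingleton (Quotient (componentSetoid H)) := (Nat.card_eq_one_iff_unique.1 hH).1
  exact Quotient.exact (s := componentSetoid H) (Subsingleton.elim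
    (Quotient.mk _ ⟨x, hV ▸ Set.mem_univ x⟩) (Quotient.mk _ ⟨y, hV ▸ Set.mem_univ y⟩))

theorem connected_or_connected_of_numComponents_eq_two {α β : Type*} {H : Graph α β}
    (hV : H.vertexSet = Set.univ) (hH : numComponents H = 2) {x y : α}
    (hxy : ¬ Connected H x y) (z : α) : Connected H z x ∨ Connected H z y := by
  by_contra! hcon
  have hf : Function.Injective (![Quotient.mk (componentSetoid H) ⟨x, hV ▸ Set.mem_univ x⟩,
      Quotient.mk _ ⟨y, hV ▸ Set.mem_univ y⟩, Quotient.mk _ ⟨z, hV ▸ Set.mem_univ z⟩]) := by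
    have h1 := fun h => hxy (Quotient.exact (s := componentSetoid H)
      (a := ⟨x, hV ▸ Set.mem_univ x⟩) (b := ⟨y, hV ▸ Set.mem_univ y⟩) h)
    have h2 := fun h => hcon.1 (Quotient.exact (s := componentSetoid H)
      (a := ⟨z, hV ▸ Set.mem_univ z⟩) (b := ⟨x, hV ▸ Set.mem_univ x⟩) h)
    have h3 := fun h => hcon.2 (Quotient.exact (s := componentSetoid H)
      (a := ⟨z, hV ▸ Set.mem_univ z⟩) (b := ⟨y, hV ▸ Set.mem_univ y⟩) h)
    intro i j hij
    fin_cases i <;> fin_cases j <;>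
      first
        | rfl
        | exact absurd hij h1
        | exact absurd hij.symm h1
        | exact absurd hij h2
        | exact absurd hij.symm h2
        | exact absurd hij h3
        | exact absurd hij.symm h3
  have : Finite (Quotient (componentSetoid H)) :=
    Nat.finite_of_card_ne_zero (by unfold numComponents at hH; omega)
  have := Nat.card_le_card_of_injective _ hf
  unfold numComponents at hH
  simp [hH] at this

theorem spanningForests_one_eq_image :
    spanningForests (wheel (m + 1)) 1 =
      wordGraph '' {p | IsParentWord p ∧ ∀ i, p i ≠ none} := by
  ext H
  constructor
  · rintro ⟨hs, ha, hc⟩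
    have hconn := connected_of_numComponents_eq_one hs.vertexSet_eq hc
    obtain ⟨pe, pv, h, hF⟩ := ha.exists_rootedAt (R := {none})
      (fun x => ⟨none, rfl, hconn _ _⟩) (by rintro r rfl s rfl -; rfl)
    obtain ⟨p, hp, hpH, hpR⟩ := hF.exists_isParentWord hs rfl
    exact ⟨p, ⟨hp, fun i => by simp [hpR]⟩, hpH⟩
  · rintro ⟨p, ⟨hp, hp0⟩, rfl⟩
    refine ⟨wordGraph_isSpanningSubgraph p, hp.isAcyclic, ?_⟩
    have : wordRoots p = {none} := by
      ext x
      rcases x with - | i <;> simp [hp0]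
    rw [hp.numComponents_eq, this, Set.ncard_singleton]

theorem injOn_wordGraph (P : (Fin (m + 1) → Option Dir) → Prop) (S : Set (Fin (m + 1))) :
    Set.InjOn (wordGraph (m := m)) {p | IsParentWord p ∧ (∀ i, p i = none ↔ i ∈ S) ∧ P p} :=
  fun _ hp _ hq hpq => hp.1.ext hq.1 (fun i => (hp.2.1 i).trans (hq.2.1 i).symm) hpq

/-- The vertices at distance at most `t` from `u` on its right are assigned the edges towards `u`,
or those at distance at least `t` are. -/
def RunsTo (p : Fin (m + 1) → Option Dir) (u t : Fin (m + 1)) : Prop :=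
  (∀ j, j ≠ 0 → j ≤ t → p (u + j) = some left) ∨ (∀ j, t ≤ j → p (u + j) = some right)

theorem connected_of_runsTo {p : Fin (m + 1) → Option Dir} {u : Fin (m + 1)} :
    ∀ t, RunsTo p u t → Connected (wordGraph p) (some (u + t)) (some u) := by
  rintro t (ht | ht)
  · induction t using Fin.induction with
    | zero => rw [add_zero]; exact .refl
    | succ t ih =>
      have h1 := wordGraph_isLink (ht t.succ (Fin.succ_ne_zero t) le_rfl)
      refine (connected_of_isLink h1).trans ?_
      have h2 : u + t.succ - 1 = u + t.castSucc := by
        rw [← Fin.coeSucc_eq_succ]; abel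
      simp only [dirEnd, h2]
      exact ih fun j hj hjt => ht j hj (hjt.trans (Fin.castSucc_lt_succ).le)
  · induction t using Fin.reverseInduction with
    | last =>
      refine (connected_of_isLink (wordGraph_isLink (ht _ le_rfl))).trans ?_
      simp only [dirEnd, add_assoc, Fin.last_add_one, add_zero]
      exact .refl
    | cast t ih =>
      refine (connected_of_isLink (wordGraph_isLink (ht _ le_rfl))).trans ?_
      simp only [dirEnd, add_assoc, Fin.coeSucc_eq_succ]
      exact ih fun j hjt => ht j ((Fin.castSucc_lt_succ).le.trans hjt)

/-- The path of parents from `u + t` to `u` avoids the centre, so it stays on the rim. It cannot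
turn round, since a turn creates a factor `right left`. The induction follows this path by height.
-/
theorem IsParentWord.runsTo_of_connected {p : Fin (m + 1) → Option Dir} (hp : IsParentWord p)
    {u : Fin (m + 1)} (hu : ∀ i, p i = none ↔ i = u)
    (hc : ¬ Connected (wordGraph p) none (some u)) :
    ∀ t, t ≠ 0 → Connected (wordGraph p) (some (u + t)) (some u) → RunsTo p u t := by
  obtain ⟨pe, pv, h, hF, hpe⟩ := hp.exists_rootedAt
  suffices H : ∀ k t, h (some (u + t)) ≤ k → t ≠ 0 →
      Connected (wordGraph p) (some (u + t)) (some u) → RunsTo p u t from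
    fun t => H _ t le_rfl
  intro k
  induction k with
  | zero =>
    intro t hk ht
    have : some (u + t) ∉ wordRoots p := by simp [hu, ht]
    have := hF.height_lt _ this
    omega
  | succ k ih =>
    intro t hk ht hconn
    have hroot : p (u + t) ≠ none := by simp [hu, ht]
    obtain ⟨d, hd⟩ := Option.ne_none_iff_exists'.1 hroot
    have hlt := hF.height_lt (some (u + t)) (by simpa using hroot)
    rw [(hpe _ d hd).2] at hlt
    have hconn' := (connected_of_isLink (wordGraph_isLink hd)).symm.trans hconn
    cases d with
    | spoke => exact absurd hconn' hc
    | right =>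
      simp only [dirEnd, add_assoc] at hlt hconn'
      -- Positions are offsets from `u`: `t + 1` wraps to `0` exactly when the next vertex is `u`,
      -- where the run ends.
      have hstep : ∀ j, t ≤ j → j = t ∨ (t + 1 ≠ 0 ∧ t + 1 ≤ j) := by
        intro j hj
        induction t using Fin.lastCases with
        | last => exact .inl (le_antisymm (Fin.le_last _) hj)
        | cast t =>
          rw [Fin.coeSucc_eq_succ]
          rcases hj.eq_or_lt with rfl | hj
          · exact .inl rfl
          · exact .inr ⟨Fin.succ_ne_zero _, Fin.castSucc_lt_iff_succ_le.1 hj⟩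
      refine .inr fun j hj => ?_
      rcases hstep j hj with rfl | ⟨h0, hj⟩
      · exact hd
      · rcases ih (t + 1) (by omega) h0 hconn' with hr | hr
        · exact absurd (by simpa [add_assoc] using hr (t + 1) h0 le_rfl) (hp.not_right_left _ hd)
        · exact hr j hj
    | left =>
      have h1 : u + t - 1 = u + (t - 1) := by abel
      simp only [dirEnd, h1] at hlt hconn'
      have hstep : ∀ j, j ≠ 0 → j ≤ t → j = t ∨ (t - 1 ≠ 0 ∧ j ≤ t - 1) := by
        intro j hj0 hj
        obtain ⟨t, rfl⟩ := Fin.exists_succ_eq.2 ht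
        have h2 : t.succ - 1 = t.castSucc := by
          rw [← Fin.coeSucc_eq_succ]; abel
        rw [h2]
        rcases hj.eq_or_lt with rfl | hj
        · exact .inl rfl
        · have h3 : j ≤ t.castSucc := Fin.le_castSucc_iff.2 hj
          refine .inr ⟨fun h0 => hj0 ?_, h3⟩
          rw [h0] at h3
          exact Fin.le_zero_iff.1 h3
      refine .inl fun j hj0 hj => ?_
      rcases hstep j hj0 hj with rfl | ⟨h0, hj⟩
      · exact hd
      · rcases ih (t - 1) (by omega) h0 hconn' with hr | hr
        · exact hr j hj0 hj
        · exact absurd (by rw [← h1, sub_add_cancel]; exact hd)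
            (hp.not_right_left _ (hr (t - 1) le_rfl))

/-- The component of `u` is rooted at `u` and the other at the centre; `RunsTo` then says that `u +
t` lies in the tree of `u`. -/
theorem separatingForests_eq_image (u t : Fin (m + 1)) (ht : t ≠ 0) :
    {H ∈ spanningForests (wheel (m + 1)) 2 |
        ¬ Connected H none (some u) ∧ Connected H none (some (u + t))} =
      wordGraph '' {p | IsParentWord p ∧ (∀ i, p i = none ↔ i ∈ ({u} : Set (Fin (m + 1)))) ∧
        ¬ RunsTo p u t} := by
  ext H
  constructor
  · rintro ⟨⟨hs, ha, hc⟩, hu, hv⟩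
    have hconn := connected_or_connected_of_numComponents_eq_two hs.vertexSet_eq hc hu
    obtain ⟨pe, pv, h, hF⟩ := ha.exists_rootedAt (R := {none, some u})
      (fun x => by simpa using hconn x) (by
        rintro r (rfl | rfl) s (rfl | rfl) hrs
        · rfl
        · exact absurd hrs hu
        · exact absurd hrs.symm hu
        · rfl)
    obtain ⟨p, hp, rfl, hpR⟩ := hF.exists_isParentWord hs (by simp)
    exact ⟨p, ⟨hp, fun i => by simp [hpR], fun hr => hu (hv.trans (connected_of_runsTo t hr))⟩, rfl⟩
  · rintro ⟨p, ⟨hp, hpu, hrun⟩, rfl⟩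
    have hroots : wordRoots p = {none, some u} := by
      ext x
      rcases x with - | i <;> simp [hpu]
    have hc : numComponents (wordGraph p) = 2 := by
      rw [hp.numComponents_eq, hroots, Set.ncard_pair (by simp)]
    have hu : ¬ Connected (wordGraph p) none (some u) := by
      obtain ⟨pe, pv, h, hF, hpe⟩ := hp.exists_rootedAt
      obtain ⟨ρ, -, h2, -, h4⟩ := hF.exists_root
      rw [h4, h2 _ (by simp), h2 _ (by simp [hpu])]
      simp
    refine ⟨⟨wordGraph_isSpanningSubgraph p, hp.isAcyclic, hc⟩, hu, ?_⟩
    rcases connected_or_connected_of_numComponents_eq_two rfl hc hu (some (u + t)) with h | h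
    · exact h.symm
    · exact absurd (hp.runsTo_of_connected (by simpa using hpu) hu t ht h) hrun

theorem finite_graph {α β : Type*} [Finite α] [Finite β] : Finite (Graph α β) :=
  Finite.of_injective (fun H : Graph α β => (H.vertexSet, H.IsLink)) fun G H hGH =>
    Graph.ext (congrArg Prod.fst hGH) fun e x y => by
      rw [show G.IsLink = H.IsLink from congrArg Prod.snd hGH]

theorem numSpanningTrees_wheel (m : ℕ) :
    numSpanningTrees (wheel (m + 1)) =
      {p : Fin (m + 1) → Option Dir | IsParentWord p ∧ ∀ i, p i ≠ none}.ncard := by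
  rw [numSpanningTrees, spanningForests_one_eq_image, Set.InjOn.ncard_image]
  exact fun p hp q hq hpq => hp.1.ext hq.1 (fun i => by simp [hp.2 i, hq.2 i]) hpq

/-- The two terms separate the forests by which of the two vertices shares the component of the
centre; the second is the first seen from `u + t`. -/
theorem numSeparatingForests_wheel (u t : Fin (m + 1)) (ht : t ≠ 0) :
    numSeparatingForests (wheel (m + 1)) (some u) (some (u + t)) =
      {p : Fin (m + 1) → Option Dir | IsParentWord p ∧
        (∀ i, p i = none ↔ i ∈ ({u} : Set (Fin (m + 1)))) ∧ ¬ RunsTo p u t}.ncard +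
      {p : Fin (m + 1) → Option Dir | IsParentWord p ∧
        (∀ i, p i = none ↔ i ∈ ({u + t} : Set (Fin (m + 1)))) ∧ ¬ RunsTo p (u + t) (-t)}.ncard := by
  have := finite_graph (α := Option (Fin (m + 1))) (β := Fin (m + 1) ⊕ Fin (m + 1))
  rw [← (injOn_wordGraph _ _).ncard_image,
    ← (injOn_wordGraph _ _).ncard_image,
    ← separatingForests_eq_image u t ht,
    ← separatingForests_eq_image (u + t) (-t) (neg_ne_zero.2 ht),
    ← Set.ncard_union_eq ?_ (Set.toFinite _) (Set.toFinite _), numSeparatingForests]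
  · congr 1
    ext H
    simp only [add_neg_cancel_right, Set.mem_ofPred, Set.mem_union]
    constructor
    · rintro ⟨hH, huv⟩
      rcases connected_or_connected_of_numComponents_eq_two hH.1.vertexSet_eq hH.2.2 huv none
        with h | h
      · exact .inr ⟨hH, fun h' => huv (h.symm.trans h'), h⟩
      · exact .inl ⟨hH, fun h' => huv (h'.symm.trans h), h⟩
    · rintro (⟨hH, h1, h2⟩ | ⟨hH, h1, h2⟩)
      · exact ⟨hH, fun h => h1 (h2.trans h.symm)⟩
      · exact ⟨hH, fun h => h1 (h2.trans h)⟩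
  · rw [Set.disjoint_left]
    rintro H ⟨-, -, h1⟩ ⟨-, h2, -⟩
    exact h2 h1

end Forests

/-! ### Counting words by Fibonacci numbers -/

section Count

open Dir

variable {m : ℕ}

/-- No `left` follows immediately after a `right`. -/
def NoRightLeft (w : Fin m → Dir) : Prop :=
  ∀ i j : Fin m, j.val = i.val + 1 → w i = right → w j ≠ left

/-- The condition on the next letter is quantified over `i.val = 0` so that it also covers the empty
word. -/
theorem noRightLeft_cons {a : Dir} {w : Fin m → Dir} :
    NoRightLeft (Fin.cons a w : Fin (m + 1) → Dir) ↔
      NoRightLeft w ∧ (a = right → ∀ i : Fin m, i.val = 0 → w i ≠ left) := by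
  constructor
  · intro h
    exact ⟨fun i j hij => by simpa using h i.succ j.succ (by simp [hij]),
      fun ha i hi => by simpa [ha] using h 0 i.succ (by simp [hi])⟩
  · rintro ⟨h1, h2⟩ i j hij
    induction j using Fin.cases with
    | zero => simp at hij
    | succ j =>
      induction i using Fin.cases with
      | zero => simpa using fun ha => h2 ha j (by simpa using hij)
      | succ i => simpa using h1 i j (by simpa using hij)

theorem noRightLeft_snoc_right {w : Fin m → Dir} :
    NoRightLeft (Fin.snoc (α := fun _ => Dir) w right) ↔ NoRightLeft w := by
  constructor
  · intro h i j hij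
    simpa using h i.castSucc j.castSucc (by simpa using hij)
  · intro h i j hij
    induction j using Fin.lastCases with
    | last => simp
    | cast j =>
      induction i using Fin.lastCases with
      | last =>
        have := j.2
        simp at hij
        omega
      | cast i => simpa using h i j (by simpa using hij)

theorem cons_injective (a : Dir) :
    Function.Injective fun w : Fin m → Dir => (Fin.cons a w : Fin (m + 1) → Dir) :=
  Fin.cons_right_injective (α := fun _ => Dir) a

theorem ncard_noRightLeft_head_left (m : ℕ) :
    {w : Fin (m + 1) → Dir | NoRightLeft w ∧ w 0 = left}.ncard =
      {w : Fin m → Dir | NoRightLeft w}.ncard := by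
  rw [← Set.ncard_image_of_injective _ (cons_injective (m := m) left)]
  congr 1
  ext w
  induction w using Fin.consCases with
  | cons a w =>
    simp only [Set.mem_ofPred, Set.mem_image, noRightLeft_cons, Fin.cons_zero, Fin.cons_inj]
    constructor
    · rintro ⟨⟨h, -⟩, rfl⟩
      exact ⟨w, h, rfl, rfl⟩
    · rintro ⟨_, h, rfl, rfl⟩
      exact ⟨⟨h, by simp⟩, rfl⟩

theorem ncard_noRightLeft_succ (m : ℕ) :
    {w : Fin (m + 1) → Dir | NoRightLeft w}.ncard =
      2 * {w : Fin m → Dir | NoRightLeft w}.ncard +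
        {w : Fin m → Dir | NoRightLeft w ∧ ∀ i : Fin m, i.val = 0 → w i ≠ left}.ncard := by
  have hset : {w : Fin (m + 1) → Dir | NoRightLeft w} =
      ((fun w : Fin m → Dir => (Fin.cons spoke w : Fin (m + 1) → Dir)) '' {w | NoRightLeft w} ∪
      (fun w : Fin m → Dir => (Fin.cons left w : Fin (m + 1) → Dir)) '' {w | NoRightLeft w}) ∪
      (fun w : Fin m → Dir => (Fin.cons right w : Fin (m + 1) → Dir)) ''
        {w | NoRightLeft w ∧ ∀ i : Fin m, i.val = 0 → w i ≠ left} := by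
    ext w
    induction w using Fin.consCases with
    | cons a w =>
      cases a <;> simp [noRightLeft_cons, Fin.cons_inj]
  rw [hset, Set.ncard_union_eq _ (Set.toFinite _) (Set.toFinite _),
    Set.ncard_union_eq _ (Set.toFinite _) (Set.toFinite _),
    Set.ncard_image_of_injective _ (cons_injective spoke),
    Set.ncard_image_of_injective _ (cons_injective left),
    Set.ncard_image_of_injective _ (cons_injective right), two_mul]
  · rw [Set.disjoint_left]
    rintro _ ⟨w, -, rfl⟩ ⟨w', -, h⟩
    simpa using congrFun h 0
  · rw [Set.disjoint_left]
    rintro _ (⟨w, -, rfl⟩ | ⟨w, -, rfl⟩) ⟨w', -, h⟩ <;> simpa using congrFun h 0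

/-- With A(m) the count, an initial `spoke` or `left` is free, while an initial `right` forbids the
A(m) continuations that start with `left`. So A(m+2) = 3A(m+1) - A(m), the recurrence of the
even-indexed Fibonacci numbers. -/
theorem ncard_noRightLeft : ∀ m : ℕ,
    {w : Fin m → Dir | NoRightLeft w}.ncard = Nat.fib (2 * m + 2)
  | 0 => by
    have : {w : Fin 0 → Dir | NoRightLeft w} = {Fin.elim0} := by
      ext w
      simp only [Set.mem_ofPred, Set.mem_singleton_iff]
      exact ⟨fun _ => Subsingleton.elim _ _, fun _ i => i.elim0⟩
    rw [this, Set.ncard_singleton]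
    rfl
  | 1 => by
    have : {w : Fin 0 → Dir | NoRightLeft w ∧ ∀ i : Fin 0, i.val = 0 → w i ≠ left} =
        {w : Fin 0 → Dir | NoRightLeft w} := by
      ext w
      simp
    rw [ncard_noRightLeft_succ, this, ncard_noRightLeft 0]
    rfl
  | m + 2 => by
    have hsplit : {w : Fin (m + 1) → Dir | NoRightLeft w}.ncard =
        {w : Fin (m + 1) → Dir | NoRightLeft w ∧ w 0 = left}.ncard +
        {w : Fin (m + 1) → Dir | NoRightLeft w ∧
          ∀ i : Fin (m + 1), i.val = 0 → w i ≠ left}.ncard := by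
      rw [← Set.ncard_union_eq _ (Set.toFinite _) (Set.toFinite _)]
      · congr 1
        ext w
        have : (∀ i : Fin (m + 1), i.val = 0 → w i ≠ left) ↔ w 0 ≠ left :=
          ⟨fun h => h 0 rfl, fun h i hi => by rwa [show i = 0 from Fin.ext hi]⟩
        simp only [Set.mem_ofPred, Set.mem_union, this]
        tauto
      · rw [Set.disjoint_left]
        rintro w ⟨-, h⟩ ⟨-, h'⟩
        exact h' 0 rfl h
    rw [ncard_noRightLeft_head_left, ncard_noRightLeft m, ncard_noRightLeft (m + 1)] at hsplit
    rw [ncard_noRightLeft_succ, ncard_noRightLeft (m + 1)]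
    have h1 : Nat.fib (2 * m + 4) = Nat.fib (2 * m + 2) + Nat.fib (2 * m + 3) := Nat.fib_add_two
    have h2 : Nat.fib (2 * m + 5) = Nat.fib (2 * m + 3) + Nat.fib (2 * m + 4) := Nat.fib_add_two
    have h3 : Nat.fib (2 * m + 6) = Nat.fib (2 * m + 4) + Nat.fib (2 * m + 5) := Nat.fib_add_two
    rw [show 2 * (m + 2) + 2 = 2 * m + 6 by ring]
    rw [show 2 * (m + 1) + 2 = 2 * m + 4 by ring] at hsplit ⊢
    omega

theorem ncard_noRightLeft_prefix_left (t m : ℕ) :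
    {w : Fin (m + t) → Dir | NoRightLeft w ∧ ∀ j : Fin (m + t), j.val < t → w j = left}.ncard =
      Nat.fib (2 * m + 2) := by
  induction t with
  | zero => simpa using ncard_noRightLeft m
  | succ t ih =>
    rw [← ih, ← Set.ncard_image_of_injective _ (cons_injective (m := m + t) left)]
    congr 1
    ext w
    induction w using Fin.consCases with
    | cons a w =>
      simp only [Set.mem_ofPred, Set.mem_image, noRightLeft_cons, Fin.cons_inj]
      constructor
      · rintro ⟨⟨h, -⟩, h'⟩
        refine ⟨w, ⟨h, fun j hj => ?_⟩, ?_, rfl⟩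
        · simpa using h' j.succ (by simpa using hj)
        · simpa using (h' 0 (by simp)).symm
      · rintro ⟨_, ⟨h, h'⟩, rfl, rfl⟩
        refine ⟨⟨h, by simp⟩, fun j hj => ?_⟩
        induction j using Fin.cases with
        | zero => rfl
        | succ j => simpa using h' j (by simpa using hj)

/-- Exchange `left` and `right`. -/
def Dir.flip : Dir → Dir
  | spoke => spoke
  | right => left
  | left => right

@[simp] theorem Dir.flip_flip (d : Dir) : d.flip.flip = d := by cases d <;> rfl

theorem Dir.flip_eq_right {d : Dir} : d.flip = right ↔ d = left := by cases d <;> simp [Dir.flip]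

theorem Dir.flip_eq_left {d : Dir} : d.flip = left ↔ d = right := by cases d <;> simp [Dir.flip]

/-- Read a word backwards, exchanging `left` and `right`. -/
def reflectWord (w : Fin m → Dir) : Fin m → Dir := fun i => (w i.rev).flip

theorem reflectWord_involutive : Function.Involutive (reflectWord (m := m)) := by
  intro w
  funext i
  simp [reflectWord]

theorem NoRightLeft.reflectWord {w : Fin m → Dir} (hw : NoRightLeft w) :
    NoRightLeft (reflectWord w) := by
  intro i j hij hi hj
  rw [WheelForests.reflectWord, Dir.flip_eq_right] at hi
  rw [WheelForests.reflectWord, Dir.flip_eq_left] at hj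
  refine hw j.rev i.rev ?_ hj hi
  have := j.2
  simp only [Fin.val_rev]
  omega

/-- Reversing a word and exchanging `left` with `right` preserves `NoRightLeft` and turns a final
run of `right` into an initial run of `left`. -/
theorem ncard_noRightLeft_suffix_right (t m : ℕ) :
    {w : Fin (m + t) → Dir | NoRightLeft w ∧ ∀ j : Fin (m + t), m ≤ j.val → w j = right}.ncard =
      Nat.fib (2 * m + 2) := by
  rw [← ncard_noRightLeft_prefix_left t m,
    ← Set.ncard_image_of_injective _ (reflectWord_involutive (m := m + t)).injective]
  congr 1
  ext w
  rw [Set.mem_image_iff_of_inverse reflectWord_involutive reflectWord_involutive]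
  constructor
  · rintro ⟨h, h'⟩
    refine ⟨by simpa [reflectWord_involutive w] using h.reflectWord, fun j hj => ?_⟩
    rw [← Dir.flip_eq_right]
    simpa [reflectWord] using h' j.rev (by have := j.2; simp only [Fin.val_rev]; omega)
  · rintro ⟨h, h'⟩
    refine ⟨by simpa [reflectWord_involutive w] using h.reflectWord, fun j hj => ?_⟩
    rw [← Dir.flip_eq_left]
    simpa [reflectWord] using h' j.rev (by have := j.2; simp only [Fin.val_rev]; omega)

theorem ncard_noRightLeft_avoid_runs (a b : ℕ) :
    {w : Fin (a + 1 + b) → Dir | NoRightLeft w ∧ ¬ ((∀ j, j.val < a + 1 → w j = left) ∨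
      ∀ j, a ≤ j.val → w j = right)}.ncard + Nat.fib (2 * b + 2) + Nat.fib (2 * a + 2) =
      Nat.fib (2 * (a + 1 + b) + 2) := by
  have h1 : {w : Fin (a + 1 + b) → Dir | NoRightLeft w ∧ ∀ j, j.val < a + 1 → w j = left}.ncard =
      Nat.fib (2 * b + 2) := by
    rw [add_comm (a + 1) b]
    exact ncard_noRightLeft_prefix_left (a + 1) b
  have h2 : {w : Fin (a + 1 + b) → Dir | NoRightLeft w ∧ ∀ j, a ≤ j.val → w j = right}.ncard =
      Nat.fib (2 * a + 2) := by
    rw [add_assoc]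
    exact ncard_noRightLeft_suffix_right (1 + b) a
  rw [← h1, ← h2, ← ncard_noRightLeft, add_assoc,
    ← Set.ncard_union_eq _ (Set.toFinite _) (Set.toFinite _),
    ← Set.ncard_union_eq _ (Set.toFinite _) (Set.toFinite _)]
  · congr 1
    ext w
    simp only [Set.mem_ofPred, Set.mem_union]
    tauto
  · rw [Set.disjoint_left]
    rintro w ⟨-, h⟩ (⟨-, h'⟩ | ⟨-, h'⟩)
    · exact h (.inl h')
    · exact h (.inr h')
  · rw [Set.disjoint_left]
    rintro w ⟨-, h⟩ ⟨-, h'⟩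
    -- The letter at position `a` belongs to both runs, so they exclude each other.
    have h3 := h ⟨a, by omega⟩ (by simp)
    rw [h' ⟨a, by omega⟩ le_rfl] at h3
    cases h3

/-- The word that assigns nothing to `u`, and the letters of `w` to the vertices after `u`. -/
def rootedWord (u : Fin (m + 1)) (w : Fin m → Dir) : Fin (m + 1) → Option Dir :=
  fun i => (Fin.cons none fun j => some (w j) : Fin (m + 1) → Option Dir) (i - u)

theorem rootedWord_add (u j : Fin (m + 1)) (w : Fin m → Dir) :
    rootedWord u w (u + j) = (Fin.cons none fun j => some (w j) : Fin (m + 1) → Option Dir) j := by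
  rw [rootedWord, add_sub_cancel_left]

@[simp] theorem rootedWord_add_succ (u : Fin (m + 1)) (j : Fin m) (w : Fin m → Dir) :
    rootedWord u w (u + j.succ) = some (w j) := by
  rw [rootedWord_add, Fin.cons_succ]

@[simp] theorem rootedWord_self (u : Fin (m + 1)) (w : Fin m → Dir) : rootedWord u w u = none := by
  simp [rootedWord]

theorem rootedWord_injective (u : Fin (m + 1)) : Function.Injective (rootedWord u) := by
  intro w w' h
  funext j
  have := congrFun h (u + j.succ)
  simpa using this

theorem rootedWord_eq_none_iff (u i : Fin (m + 1)) (w : Fin m → Dir) :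
    rootedWord u w i = none ↔ i = u := by
  obtain ⟨j, rfl⟩ : ∃ j, i = u + j := ⟨i - u, by abel⟩
  rcases j.eq_zero_or_eq_succ with rfl | ⟨j, rfl⟩
  · simp
  · simp [Fin.succ_ne_zero]

/-- The gap at `u` breaks every factor across the wrap-around and is itself neither `right` nor
`left`. -/
theorem isParentWord_rootedWord_iff (u : Fin (m + 1)) (w : Fin m → Dir) :
    IsParentWord (rootedWord u w) ↔ NoRightLeft w := by
  constructor
  · intro h i j hij hi hj
    have h1 := h.not_right_left (u + i.succ) (by simp [hi])
    have h2 : i.succ + 1 = j.succ := by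
      have := j.2
      rw [← Fin.coeSucc_eq_succ (a := j)]
      congr 1
      exact Fin.ext (by simp [hij])
    rw [add_assoc, h2, rootedWord_add_succ, hj] at h1
    exact h1 rfl
  · intro h
    refine ⟨fun i hi hi' => ?_, ⟨u, by simp⟩, ⟨u, by simp⟩⟩
    obtain ⟨j, rfl⟩ : ∃ j, i = u + j := ⟨i - u, by abel⟩
    rcases j.eq_zero_or_eq_succ with rfl | ⟨j, rfl⟩
    · simp at hi
    rw [add_assoc] at hi'
    rcases (j.succ + 1).eq_zero_or_eq_succ with h0 | ⟨k, hk⟩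
    · simp [h0] at hi'
    · rw [hk] at hi'
      simp only [rootedWord_add_succ, Option.some.injEq] at hi hi'
      refine h j k ?_ hi hi'
      have h1 := congrArg Fin.val hk
      rw [Fin.val_add_one] at h1
      split_ifs at h1 with h2
      · simp at h1
      · simpa using h1.symm

theorem runsTo_rootedWord_iff (u : Fin (m + 1)) (t : Fin m) (w : Fin m → Dir) :
    RunsTo (rootedWord u w) u t.succ ↔
      (∀ j : Fin m, j.val < t.val + 1 → w j = left) ∨ ∀ j : Fin m, t.val ≤ j.val → w j = right := by
  refine or_congr ⟨fun h j hj => ?_, fun h j hj0 hj => ?_⟩ ⟨fun h j hj => ?_, fun h j hj => ?_⟩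
  · have hle : j ≤ t := Nat.le_of_lt_succ hj
    simpa using h j.succ (Fin.succ_ne_zero j) (Fin.succ_le_succ_iff.2 hle)
  · obtain ⟨j, rfl⟩ := Fin.exists_succ_eq.2 hj0
    simpa using h j (Nat.lt_succ_of_le (Fin.succ_le_succ_iff.1 hj))
  · have hle : t ≤ j := hj
    simpa using h j.succ (Fin.succ_le_succ_iff.2 hle)
  · rcases j.eq_zero_or_eq_succ with rfl | ⟨j, rfl⟩
    · simp at hj
    · simpa using h j (Fin.succ_le_succ_iff.1 hj)

theorem exists_rootedWord_eq {u : Fin (m + 1)} {p : Fin (m + 1) → Option Dir}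
    (hp : ∀ i, p i = none ↔ i = u) : ∃ w, rootedWord u w = p := by
  refine ⟨fun j => (p (u + j.succ)).getD spoke, funext fun i => ?_⟩
  obtain ⟨j, rfl⟩ : ∃ j, i = u + j := ⟨i - u, by abel⟩
  rcases j.eq_zero_or_eq_succ with rfl | ⟨j, rfl⟩
  · simp [(hp u).2 rfl]
  · rw [rootedWord_add_succ]
    obtain ⟨d, hd⟩ := Option.ne_none_iff_exists'.1
      (mt (hp (u + j.succ)).1 (by simp [Fin.succ_ne_zero]))
    simp [hd]

theorem ncard_parentWord_not_runsTo {a b : ℕ} (hm : m = a + 1 + b) (u t : Fin (m + 1))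
    (ht : t.val = a + 1) :
    {p : Fin (m + 1) → Option Dir | IsParentWord p ∧
        (∀ i, p i = none ↔ i ∈ ({u} : Set (Fin (m + 1)))) ∧ ¬ RunsTo p u t}.ncard +
      Nat.fib (2 * b + 2) + Nat.fib (2 * a + 2) = Nat.fib (2 * m + 2) := by
  subst hm
  obtain ⟨t, rfl⟩ := Fin.exists_succ_eq.2 (fun h0 : t = 0 => by simp [h0] at ht)
  obtain ⟨t, htm⟩ := t
  obtain rfl : t = a := by simpa using ht
  rw [← ncard_noRightLeft_avoid_runs, ← Set.ncard_image_of_injective _ (rootedWord_injective u)]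
  congr 3
  ext p
  simp only [Set.mem_ofPred, Set.mem_image, Set.mem_singleton_iff]
  constructor
  · rintro ⟨h1, h2, h3⟩
    obtain ⟨w, rfl⟩ := exists_rootedWord_eq h2
    rw [runsTo_rootedWord_iff] at h3
    exact ⟨w, ⟨(isParentWord_rootedWord_iff u w).1 h1, h3⟩, rfl⟩
  · rintro ⟨w, ⟨h1, h2⟩, rfl⟩
    refine ⟨(isParentWord_rootedWord_iff u w).2 h1, fun i => rootedWord_eq_none_iff u i w, ?_⟩
    rwa [runsTo_rootedWord_iff]

/-- An initial `left` and a final `right` constrain no neighbour, so both can be deleted. A single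
letter cannot be both, which gives f₀ = 0. -/
theorem ncard_noRightLeft_head_left_last_right (m : ℕ) :
    {w : Fin (m + 1) → Dir | NoRightLeft w ∧ w (Fin.last m) = right ∧ w 0 = left}.ncard =
      Nat.fib (2 * m) := by
  cases m with
  | zero =>
    rw [show Nat.fib (2 * 0) = 0 from rfl, Set.ncard_eq_zero, Set.eq_empty_iff_forall_notMem]
    rintro w ⟨-, h1, h2⟩
    rw [show Fin.last 0 = 0 from rfl, h2] at h1
    cases h1
  | succ m =>
    have hsnoc : Function.Injective fun w : Fin m → Dir =>
        (Fin.snoc (α := fun _ => Dir) w right : Fin (m + 1) → Dir) :=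
      Fin.snoc_left_injective (α := fun _ => Dir) right
    rw [show 2 * (m + 1) = 2 * m + 2 by ring, ← ncard_noRightLeft,
      ← Set.ncard_image_of_injective _ hsnoc,
      ← Set.ncard_image_of_injective _ (cons_injective (m := m + 1) left)]
    congr 1
    ext w
    induction w using Fin.consCases with
    | cons a w =>
      induction w using Fin.snocCases with
      | snoc w b =>
        simp only [Set.mem_ofPred, Set.mem_image, noRightLeft_cons, Fin.cons_zero,
          exists_exists_and_eq_and, Fin.cons_inj, Fin.snoc_inj, ← Fin.succ_last, Fin.cons_succ,
          Fin.snoc_last]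
        constructor
        · rintro ⟨⟨h, -⟩, rfl, rfl⟩
          exact ⟨w, noRightLeft_snoc_right.1 h, rfl, rfl, rfl⟩
        · rintro ⟨_, h, rfl, rfl, rfl⟩
          exact ⟨⟨noRightLeft_snoc_right.2 h, by simp⟩, rfl, rfl⟩

/-- A linear word fails to give a tree if it ends in `right` and starts with `left`, or if it is one
of the two constant words; these cases are disjoint. -/
theorem numSpanningTrees_wheel_add (m : ℕ) :
    numSpanningTrees (wheel (m + 1)) + 2 + Nat.fib (2 * m) = Nat.fib (2 * m + 4) := by
  have hinj : Function.Injective fun (w : Fin (m + 1) → Dir) i => some (w i) := by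
    intro w w' h
    funext i
    exact Option.some.inj (congrFun h i)
  have himage : {p : Fin (m + 1) → Option Dir | IsParentWord p ∧ ∀ i, p i ≠ none} =
      (fun (w : Fin (m + 1) → Dir) i => some (w i)) ''
        {w | NoRightLeft w ∧ ¬ (w (Fin.last m) = right ∧ w 0 = left) ∧
          w ≠ (fun _ => right) ∧ w ≠ fun _ => left} := by
    ext p
    constructor
    · rintro ⟨hp, hp0⟩
      choose w hw using fun i => Option.ne_none_iff_exists'.1 (hp0 i)
      obtain rfl : p = fun i => some (w i) := funext hw
      refine ⟨w, ⟨fun i j hij hi hj => ?_, fun h => ?_, ?_, ?_⟩, rfl⟩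
      · refine hp.not_right_left i (congrArg some hi) ?_
        rw [show i + 1 = j from Fin.ext ?_, hj]
        have := j.2
        rw [Fin.val_add_one, if_neg (by rintro rfl; simp at hij; omega), hij]
      · refine hp.not_right_left (Fin.last m) (congrArg some h.1) ?_
        rw [Fin.last_add_one, h.2]
      · rintro rfl
        obtain ⟨i, hi⟩ := hp.exists_ne_right
        exact hi rfl
      · rintro rfl
        obtain ⟨i, hi⟩ := hp.exists_ne_left
        exact hi rfl
    · rintro ⟨w, ⟨h1, h2, h3, h4⟩, rfl⟩
      refine ⟨⟨fun i hi hi' => ?_, ?_, ?_⟩, by simp⟩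
      · simp only [Option.some.injEq] at hi hi'
        induction i using Fin.lastCases with
        | last => exact h2 ⟨hi, by rwa [Fin.last_add_one] at hi'⟩
        | cast i =>
          rw [Fin.coeSucc_eq_succ] at hi'
          exact h1 _ _ (by simp) hi hi'
      · by_contra! h
        exact h3 (funext fun i => Option.some.inj (h i))
      · by_contra! h
        exact h4 (funext fun i => Option.some.inj (h i))
  have hne : (fun _ : Fin (m + 1) => right) ≠ fun _ => left := fun h => by
    have := congrFun h 0
    cases this
  rw [numSpanningTrees_wheel, himage, Set.ncard_image_of_injective _ hinj,
    ← ncard_noRightLeft_head_left_last_right, show 2 * m + 4 = 2 * (m + 1) + 2 by ring,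
    ← ncard_noRightLeft, ← Set.ncard_pair hne, ← Set.ncard_union_eq _ (Set.toFinite _) (Set.toFinite _),
    ← Set.ncard_union_eq _ (Set.toFinite _) (Set.toFinite _)]
  · congr 1
    ext w
    have h1 : w = (fun _ => right) → NoRightLeft w ∧ ¬ (w (Fin.last m) = right ∧ w 0 = left) := by
      rintro rfl
      exact ⟨by simp [NoRightLeft], by simp⟩
    have h2 : w = (fun _ => left) → NoRightLeft w ∧ ¬ (w (Fin.last m) = right ∧ w 0 = left) := by
      rintro rfl
      exact ⟨by simp [NoRightLeft], by simp⟩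
    simp only [Set.mem_ofPred, Set.mem_union, Set.mem_insert_iff, Set.mem_singleton_iff]
    tauto
  · rw [Set.disjoint_left]
    rintro w (⟨-, h, -⟩ | rfl | rfl) ⟨-, h'⟩
    · exact h h'
    · cases h'.2
    · cases h'.1
  · rw [Set.disjoint_left]
    rintro w ⟨-, -, h1, h2⟩ (h | h)
    · exact h1 h
    · exact h2 h

/-- Seen from `v`, the offset of `u` is `b + 1`. The count is symmetric in `a` and `b`, hence the
factor 2. -/
theorem numSeparatingForests_wheel_add {a b : ℕ} (hm : m = a + b + 1) (u v : Fin (m + 1))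
    (h : (v - u).val = a + 1) :
    numSeparatingForests (wheel (m + 1)) (some u) (some v) +
      2 * (Nat.fib (2 * a + 2) + Nat.fib (2 * b + 2)) = 2 * Nat.fib (2 * m + 2) := by
  have h0 : v - u ≠ 0 := by
    rw [← Fin.val_ne_zero_iff, h]
    omega
  have key := numSeparatingForests_wheel u (v - u) h0
  have hneg : (-(v - u)).val = b + 1 := by
    rw [Fin.val_neg, if_neg h0, h]
    omega
  rw [add_sub_cancel] at key
  have h1 := ncard_parentWord_not_runsTo (a := a) (b := b) (by omega) u (v - u) h
  have h2 := ncard_parentWord_not_runsTo (a := b) (b := a) (by omega) v (-(v - u)) hneg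
  omega

end Count

/-! ### Fibonacci–Lucas identities and the closed forms -/

section Identities

theorem lucas_add_fib : ∀ j, lucas j + Nat.fib j = 2 * Nat.fib (j + 1)
  | 0 => rfl
  | 1 => rfl
  | j + 2 => by
    have h1 := lucas_add_fib j
    have h2 := lucas_add_fib (j + 1)
    have h3 : Nat.fib (j + 2) = Nat.fib j + Nat.fib (j + 1) := Nat.fib_add_two
    have h4 : Nat.fib (j + 3) = Nat.fib (j + 1) + Nat.fib (j + 2) := Nat.fib_add_two
    rw [lucas]
    change _ = 2 * Nat.fib (j + 3)
    change _ = 2 * Nat.fib (j + 2) at h2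
    omega

/-- d'Ocagne's identity at even indices. -/
theorem fib_mul_fib_sub (a b : ℕ) :
    (Nat.fib (2 * (a + b)) : ℤ) * Nat.fib (2 * a + 1) -
      Nat.fib (2 * a) * Nat.fib (2 * (a + b) + 1) = Nat.fib (2 * b) := by
  induction a with
  | zero => simp
  | succ a ih =>
    have h (j : ℕ) : Nat.fib (2 * (j + 1)) = Nat.fib (2 * j) + Nat.fib (2 * j + 1) :=
      Nat.fib_add_two
    have h' (j : ℕ) : Nat.fib (2 * (j + 1) + 1) = Nat.fib (2 * j) + 2 * Nat.fib (2 * j + 1) := by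
      have h1 : Nat.fib (2 * (j + 1) + 1) = Nat.fib (2 * j + 1) + Nat.fib (2 * (j + 1)) :=
        Nat.fib_add_two
      rw [h1, h]
      ring
    -- The two-step shift (x, y) ↦ (x + y, x + 2y) has determinant 1, so the 2×2 determinant is
    -- unchanged.
    rw [show a + 1 + b = a + b + 1 by ring, h, h, h', h', ← ih]
    push_cast
    ring

/-- After substituting ℓ_j = 2f_{j+1} - f_j the products of two even-indexed terms cancel, and
d'Ocagne's identity evaluates the rest. -/
theorem fib_mul_lucas_sub (a b : ℕ) :
    (Nat.fib (2 * a) : ℤ) * (lucas (2 * (a + b)) - 2) -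
        Nat.fib (2 * (a + b)) * (lucas (2 * a) - 2) =
      2 * Nat.fib (2 * (a + b)) - 2 * (Nat.fib (2 * a) + Nat.fib (2 * b)) := by
  have h1 : (lucas (2 * a) : ℤ) = 2 * Nat.fib (2 * a + 1) - Nat.fib (2 * a) := by
    have := lucas_add_fib (2 * a)
    omega
  have h2 : (lucas (2 * (a + b)) : ℤ) = 2 * Nat.fib (2 * (a + b) + 1) - Nat.fib (2 * (a + b)) := by
    have := lucas_add_fib (2 * (a + b))
    omega
  rw [h1, h2]
  linear_combination -2 * fib_mul_fib_sub a b

/-- The case `n = 0` is false: a single vertex has one spanning tree, whereas ℓ₀ - 2 = 0. -/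
theorem numSpanningTrees_wheel_eq {n : ℕ} (hn : n ≠ 0) :
    (numSpanningTrees (wheel n) : ℤ) = lucas (2 * n) - 2 := by
  obtain ⟨m, rfl⟩ := Nat.exists_eq_add_one_of_ne_zero hn
  have h1 := numSpanningTrees_wheel_add m
  have h2 := lucas_add_fib (2 * (m + 1))
  have h3 : Nat.fib (2 * m + 2) = Nat.fib (2 * m) + Nat.fib (2 * m + 1) := Nat.fib_add_two
  have h4 : Nat.fib (2 * m + 3) = Nat.fib (2 * m + 1) + Nat.fib (2 * m + 2) := Nat.fib_add_two
  have h5 : Nat.fib (2 * m + 4) = Nat.fib (2 * m + 2) + Nat.fib (2 * m + 3) := Nat.fib_add_two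
  rw [show 2 * (m + 1) = 2 * m + 2 by ring] at h2 ⊢
  change _ = 2 * Nat.fib (2 * m + 3) at h2
  omega

theorem numSeparatingForests_wheel_eq {n : ℕ} {u v : Fin n} (huv : u ≠ v) :
    (numSeparatingForests (wheel n) (some u) (some v) : ℤ) =
      2 * Nat.fib (2 * n) -
        2 * (Nat.fib (2 * cycleDist u v) + Nat.fib (2 * (n - cycleDist u v))) := by
  obtain ⟨m, rfl⟩ := Nat.exists_eq_add_one_of_ne_zero (Fin.pos u).ne'
  have hu := u.2
  have hv := v.2
  have hval : u.val ≠ v.val := fun h => huv (Fin.ext h)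
  have hd : (v - u).val ≠ 0 := by
    rw [Fin.val_ne_zero_iff]
    exact sub_ne_zero.2 huv.symm
  have hlt := (v - u).2
  obtain ⟨a, ha⟩ := Nat.exists_eq_add_one_of_ne_zero hd
  obtain ⟨b, hb⟩ := Nat.exists_eq_add_of_lt (show a < m by omega)
  have key := numSeparatingForests_wheel_add hb u v ha
  -- The shorter arc may be either one; the formula is symmetric in the two.
  have hk : cycleDist u v = a + 1 ∧ m + 1 - cycleDist u v = b + 1 ∨
      cycleDist u v = b + 1 ∧ m + 1 - cycleDist u v = a + 1 := by
    rcases le_or_gt u.val v.val with huv | huv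
    · rw [Fin.coe_sub_iff_le.2 huv] at ha
      simp only [cycleDist]
      omega
    · rw [Fin.coe_sub_iff_lt.2 huv] at ha
      simp only [cycleDist]
      omega
  rw [show 2 * (m + 1) = 2 * m + 2 by ring]
  rcases hk with ⟨h1, h2⟩ | ⟨h1, h2⟩ <;>
  · rw [h2, h1, show 2 * (a + 1) = 2 * a + 2 by ring, show 2 * (b + 1) = 2 * b + 2 by ring]
    omega

end Identities

end WheelForests

theorem theorem2 (n k : ℕ) (u v : Fin n) (huv : u ≠ v) (hk : k = WheelForests.cycleDist u v) :
    (WheelForests.numSeparatingForests (WheelForests.wheel n) (some u) (some v) : ℤ) =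
        (Nat.fib (2 * k) : ℤ) * (WheelForests.numSpanningTrees (WheelForests.wheel n) : ℤ)
          - (Nat.fib (2 * n) : ℤ) * (WheelForests.numSpanningTrees (WheelForests.wheel k) : ℤ) ∧
    (WheelForests.numSeparatingForests (WheelForests.wheel n) (some u) (some v) : ℤ) =
        (Nat.fib (2 * k) : ℤ) * ((WheelForests.lucas (2 * n) : ℤ) - 2)
          - (Nat.fib (2 * n) : ℤ) * ((WheelForests.lucas (2 * k) : ℤ) - 2) := by
  have hu := u.2
  have hv := v.2
  have hval : u.val ≠ v.val := fun h => huv (Fin.ext h)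
  have hk0 : k ≠ 0 ∧ k ≤ n := by
    rw [hk, WheelForests.cycleDist]
    omega
  have hF := WheelForests.numSeparatingForests_wheel_eq huv
  have hid := WheelForests.fib_mul_lucas_sub k (n - k)
  rw [Nat.add_sub_cancel' hk0.2] at hid
  rw [← hk, ← hid] at hF
  rw [WheelForests.numSpanningTrees_wheel_eq (by omega),
    WheelForests.numSpanningTrees_wheel_eq hk0.1]
  exact ⟨hF, hF⟩
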